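/- Let $K\ge 1$ be a fixed integer (the number of colours). For each $i\in\{1,\dots,K\}$ let $b_{i0},b_{i1},b_{i2},\dots$ be non-negative real numbers with $b_{i0}>0$ and $b_{i1}>0$ such that the power series $B_i(\theta)=\sum_{k\ge 0} b_{ik}\theta^k/k!$ has positive radius of convergence $R_i\in(0,\infty]$. For $\theta>0$ with $B_i(\theta)<\infty$ let $\xi_i(\theta)$ be a random variable with $P(\xi_i(\theta)=k)=\dfrac{b_{ik}\theta^k}{k!\,B_i(\theta)}$, $k=0,1,2,\dots$, and let $m_i(\theta)=E\,\xi_i(\theta)$. For all $N$ and $\mathbf n=(n_1,\dots,n_K)$ choose $\theta_i=\theta_i(\mathbf n,N)>0$ with $B_i(\theta_i)<\infty$, and let $\xi_{ij}$, $1\le i\le K$, $1\le j\le N$, be independent random variables, $\xi_{ij}$ having the distribution of $\xi_i(\theta_i)$. Let all the following random vectors be defined on one probability space. For every pair $(\mathbf n,N)$ for which the events $\{\xi_{i1}+\dots+\xi_{iN}=n_i\}$, $1\le i\le K$, have positive probability, let $\boldsymbol\eta_1,\dots,\boldsymbol\eta_N$, $\boldsymbol\eta_j=(\eta_{1j},\dots,\eta_{Kj})$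 (also depending on $(\mathbf n,N)$), be random vectors with values in $\mathbb Z_{\ge 0}^K$ that obey the multi-colour generalized allocation scheme of placing $n_i$ balls of colour $i$, $1\le i\le K$, into $N$ boxes, that is, $$P\{\boldsymbol\eta_1=\mathbf k_1,\dots,\boldsymbol\eta_N=\mathbf k_N\}=\prod_{i=1}^K P\{\xi_{i1}=k_{i1},\dots,\xi_{iN}=k_{iN}\mid \xi_{i1}+\dots+\xi_{iN}=n_i\}$$ for all $\mathbf k_j=(k_{1j},\dots,k_{Kj})\in\mathbb Z_{\ge 0}^K$ with $k_{i1}+\dots+k_{iN}=n_i$ for every $i$. No assumption is made on the joint distribution for different pairs $(\mathbf n,N)$. Let $s\ge 0$ be a fixed integer, and let $\mu_{s\mathbf nN}$ be the number of boxes $j\in\{1,\dots,N\}$ with $\eta_{1j}+\dots+\eta_{Kj}=s$, i.e. the number of boxes containing exactly $s$ balls altogether, regardless of their colours. Suppose that for each $i$ we have $m_i(\theta_{\alpha_{i0}})=\alpha_{i0}$ for some $0<\theta_{\alpha_{i0}}<R_i$. Then almost surely $$\frac1N\,\mu_{s\mathbf nN}\;\longrightarrow\;\sum_{\substack{s_1,\dots,s_K\ge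 0\\ s_1+\dots+s_K=s}}\ \prod_{i=1}^K\frac{b_{is_i}\,\theta_{\alpha_{i0}}^{s_i}}{s_i!\,B_i(\theta_{\alpha_{i0}})}$$ as $N\to\infty$ and $n_i\to\infty$ in such a way that $n_i/N\to\alpha_{i0}$ for all $1\le i\le K$ (a multi-index limit over all pairs $(\mathbf n,N)$, outside one null event). -/

import Mathlib

open MeasureTheory ProbabilityTheory Filter Topology

namespace MultiColour

noncomputable section

/-- The power series `B(θ) = ∑ b_k θ^k / k!` attached to a sequence `b`. -/
def B (b : ℕ → ℝ) (θ : ℝ) : ℝ := ∑' k : ℕ, b k * θ ^ k / (k.factorial : ℝ)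

/-- The radius of convergence of `∑ b_k θ^k / k!`, a value in `[0, ∞]`. -/
def convRadius (b : ℕ → ℝ) : ENNReal :=
  (FormalMultilinearSeries.ofScalars ℝ (fun k : ℕ => b k / (k.factorial : ℝ))).radius

/-- The weight `b_k θ^k / (k! B(θ))` of the point `k`. -/
def weight (b : ℕ → ℝ) (θ : ℝ) (k : ℕ) : ℝ :=
  b k * θ ^ k / ((k.factorial : ℝ) * B b θ)

/-- The expectation `m(θ)` of the distribution with weights `weight b θ k`, `k = 0, 1, 2, …`. -/
def mean (b : ℕ → ℝ) (θ : ℝ) : ℝ := ∑' k : ℕ, (k : ℝ) * weight b θ k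

/-- `ξ i j` (colour `i`, box `j`) is an array of independent random variables such that
`P(ξ i j = k) = b_{ik} θ_i^k / (k! B_i(θ_i))`, where `θ_i > 0` and the series `B_i(θ_i)`
converges. -/
structure IsPowerSeriesArray {Ω' : Type*} [MeasurableSpace Ω'] (Q : Measure Ω') {K N : ℕ}
    (b : Fin K → ℕ → ℝ) (θ : Fin K → ℝ) (ξ : Fin K → Fin N → Ω' → ℕ) : Prop where
  measurable : ∀ i j, Measurable (ξ i j)
  indep : iIndepFun (fun p : Fin K × Fin N => ξ p.1 p.2) Q
  pos : ∀ i, 0 < θ i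
  summable : ∀ i, Summable fun k : ℕ => b i k * θ i ^ k / (k.factorial : ℝ)
  law : ∀ i j k, Q {ω | ξ i j ω = k} = ENNReal.ofReal (weight (b i) (θ i) k)

/-- The event `ξ_{i1} + … + ξ_{iN} = n_i`. -/
def sumEvent {Ω' : Type*} {K N : ℕ} (ξ : Fin K → Fin N → Ω' → ℕ) (n : Fin K → ℕ) (i : Fin K) :
    Set Ω' :=
  {ω | ∑ j, ξ i j ω = n i}

/-- The random vectors `η_1, …, η_N` with values in `ℕ^K` obey the multi-colour generalized
allocation scheme of placing `n_i` balls of colour `i`, `1 ≤ i ≤ K`, into `N` boxes that is given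
by the array `ξ`:
`P(η_1 = k_1, …, η_N = k_N) = ∏_i Q(ξ_{i1} = k_{i1}, …, ξ_{iN} = k_{iN} | ξ_{i1} + … + ξ_{iN} = n_i)`
for all `k` with `k_{i1} + … + k_{iN} = n_i` for every `i`. The number of balls of colour `i` in
box `j` at the outcome `ω` is `η j ω i`. -/
structure ObeysScheme {Ω Ω' : Type*} [MeasurableSpace Ω] [MeasurableSpace Ω']
    (P : Measure Ω) (Q : Measure Ω') {K N : ℕ} (n : Fin K → ℕ)
    (ξ : Fin K → Fin N → Ω' → ℕ) (η : Fin N → Ω → Fin K → ℕ) : Prop where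
  measurable : ∀ j, Measurable (η j)
  law : ∀ k : Fin N → Fin K → ℕ, (∀ i, ∑ j, k j i = n i) →
    P {ω | ∀ j, η j ω = k j} =
      ∏ i, ProbabilityTheory.cond Q (sumEvent ξ n i) {ω | ∀ j, ξ i j ω = k j i}

/-- The number of boxes that contain exactly `s` balls altogether, regardless of their colours. -/
def boxCount {Ω : Type*} {K N : ℕ} (η : Fin N → Ω → Fin K → ℕ) (s : ℕ) (ω : Ω) : ℕ :=
  (Finset.univ.filter fun j : Fin N => ∑ i, η j ω i = s).card

/-- The limit over pairs `(n, N)` with `N → ∞`, `n_i → ∞` and `n_i / N → α_i` for all `i`. -/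
def sectorLimit {K : ℕ} (α : Fin K → ℝ) : Filter ((Fin K → ℕ) × ℕ) :=
  comap (fun p => p.2) atTop ⊓ (⨅ i, comap (fun p => p.1 i) atTop) ⊓
    ⨅ i, comap (fun p => (p.1 i : ℝ) / (p.2 : ℝ)) (𝓝 (α i))

end

end MultiColour

/-! ### Convolution powers of a weight sequence. -/

namespace MultiColour

/-! Conditioning on the sums cancels the parameters (`prod_weight_div_sumWeight`), so the varying
`θ` may be replaced by the fixed `θ₀`, whose means are the limits `α₀`. The scheme is then an i.i.d.
product law conditioned on the colour sums, and each event has at most its product probability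
divided by the probability of the conditioning (`ObeysScheme.measure_le`).

Under the product law the box count is binomial, and Hoeffding's inequality bounds a deviation `ε N`
by `2 exp(-2 ε² N)`. No local limit theorem is needed for the denominator: it is at least `exp(-ε²
N)`, uniformly over all `n` in a narrow sector around `α₀ N` (`exists_exp_le_sumWeight`). There,
most of the variables obey the weak law, and a small proportion of them, restricted to the values
`0`, `1` and some `M` above the mean, corrects the sum to exactly `n`.

What remains is `2 exp(-ε² N)` for each `n`. The sector contains only polynomially many `n` for each
`N`, so a union bound and Borel–Cantelli give the multi-index almost sure limit, whatever the joint
law (`ae_eventually_sectorLimit`). -/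

/-- The weight of the sum `n` for `N` independent variables with weights `w`. -/
noncomputable def sumWeight (w : ℕ → ℝ) (N n : ℕ) : ℝ :=
  ∑ k ∈ Finset.piAntidiag (Finset.univ : Finset (Fin N)) n, ∏ j, w (k j)

/-- With generating functions, splitting the variables into two blocks becomes `pow_add`. -/
lemma sumWeight_eq_coeff (w : ℕ → ℝ) (N n : ℕ) :
    sumWeight w N n = PowerSeries.coeff n (PowerSeries.mk w ^ N) := by
  have h := PowerSeries.coeff_prod (fun _ : Fin N => PowerSeries.mk w) n Finset.univ
  rw [Finset.prod_const, Finset.card_univ, Fintype.card_fin] at h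
  rw [h, sumWeight]
  refine (Finset.sum_bij (fun (l : Fin N →₀ ℕ) _ => (l : Fin N → ℕ)) ?_ ?_ ?_ ?_).symm
  · intro l hl
    simpa using hl
  · intro l _ l' _ h
    exact DFunLike.coe_injective h
  · intro k hk
    exact ⟨Finsupp.equivFunOnFinite.symm k, by simpa using hk, by ext; simp⟩
  · intro l _
    simp

lemma sumWeight_nonneg {w : ℕ → ℝ} (hw : ∀ k, 0 ≤ w k) (N n : ℕ) : 0 ≤ sumWeight w N n :=
  Finset.sum_nonneg fun _ _ => Finset.prod_nonneg fun _ _ => hw _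

lemma sumWeight_add (w : ℕ → ℝ) (N M n : ℕ) :
    sumWeight w (N + M) n =
      ∑ p ∈ Finset.HasAntidiagonal.antidiagonal n, sumWeight w N p.1 * sumWeight w M p.2 := by
  simp_rw [sumWeight_eq_coeff, pow_add, PowerSeries.coeff_mul]

lemma mul_le_sumWeight_add {w : ℕ → ℝ} (hw : ∀ k, 0 ≤ w k) (N M x y : ℕ) :
    sumWeight w N x * sumWeight w M y ≤ sumWeight w (N + M) (x + y) := by
  rw [sumWeight_add]
  exact Finset.single_le_sum (f := fun p : ℕ × ℕ => sumWeight w N p.1 * sumWeight w M p.2)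
    (fun p _ => mul_nonneg (sumWeight_nonneg hw _ _) (sumWeight_nonneg hw _ _))
    (by simp : (x, y) ∈ Finset.HasAntidiagonal.antidiagonal (x + y))

lemma pow_le_sumWeight_mul {w : ℕ → ℝ} (hw : ∀ k, 0 ≤ w k) (N m : ℕ) :
    w m ^ N ≤ sumWeight w N (N * m) := by
  induction N with
  | zero => simp [sumWeight_eq_coeff]
  | succ N ih =>
    rw [pow_succ, Nat.succ_mul]
    have h1 : sumWeight w 1 m = w m := by simp [sumWeight_eq_coeff]
    calc w m ^ N * w m ≤ sumWeight w N (N * m) * sumWeight w 1 m := by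
          rw [h1]; exact mul_le_mul_of_nonneg_right ih (hw m)
      _ ≤ _ := mul_le_sumWeight_add hw _ _ _ _

/-- If the weights of `0`, `1` and `M` are at least `c`, then every sum `t` that is a bit smaller
than `M r` has weight at least `c ^ r`. -/
lemma pow_le_sumWeight {w : ℕ → ℝ} (hw : ∀ k, 0 ≤ w k) {c : ℝ} (hc : 0 ≤ c) {M : ℕ} (hM : 0 < M)
    (h0 : c ≤ w 0) (h1 : c ≤ w 1) (hcM : c ≤ w M) {r t : ℕ} (ht : t + M * M ≤ M * r) :
    c ^ r ≤ sumWeight w r t := by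
  have hu : t % M < M := Nat.mod_lt _ hM
  have hdm := Nat.div_add_mod t M
  -- Write `t = M q + u`: `q` variables take the value `M`, `u < M` take `1`, the rest take `0`. The
  -- slack `M * M` pays for the `u` ones.
  have hle : t / M + t % M ≤ r := by
    by_contra h
    push Not at h
    nlinarith [Nat.mul_le_mul_left M h.le, Nat.mul_le_mul_left M hu.le]
  obtain ⟨v, rfl⟩ := Nat.exists_eq_add_of_le hle
  generalize t / M = q at *
  generalize t % M = u at *
  have e : t = q * M + u * 1 + v * 0 := by rw [← hdm]; ring
  rw [e, pow_add, pow_add]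
  have hp : ∀ N m, c ≤ w m → c ^ N ≤ sumWeight w N (N * m) := fun N m h =>
    (pow_le_pow_left₀ hc h N).trans (pow_le_sumWeight_mul hw N m)
  calc c ^ q * c ^ u * c ^ v
      ≤ sumWeight w q (q * M) * sumWeight w u (u * 1) * sumWeight w v (v * 0) := by
        gcongr
        · exact mul_nonneg (sumWeight_nonneg hw _ _) (sumWeight_nonneg hw _ _)
        · exact sumWeight_nonneg hw _ _
        · exact hp _ _ hcM
        · exact hp _ _ h1
        · exact hp _ _ h0
    _ ≤ sumWeight w (q + u) (q * M + u * 1) * sumWeight w v (v * 0) :=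
        mul_le_mul_of_nonneg_right (mul_le_sumWeight_add hw _ _ _ _) (sumWeight_nonneg hw _ _)
    _ ≤ _ := mul_le_sumWeight_add hw _ _ _ _

/-! ### Weak law and position of the mean. -/

/-- A probability measure on `ℕ` with prescribed weights. -/
lemma exists_measure_of_hasSum {w : ℕ → ℝ} (hw : ∀ k, 0 ≤ w k) (h1 : HasSum w 1) :
    ∃ ν : Measure ℕ, IsProbabilityMeasure ν ∧ ∀ k, ν {k} = ENNReal.ofReal (w k) := by
  let p : PMF ℕ := ⟨fun k => ENNReal.ofReal (w k), by
    have := h1.summable.hasSum.tsum_eq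
    rw [← ENNReal.ofReal_one, ← h1.tsum_eq, ENNReal.ofReal_tsum_of_nonneg hw h1.summable]
    exact ENNReal.summable.hasSum⟩
  exact ⟨p.toMeasure, inferInstance, fun k => by
    rw [PMF.toMeasure_apply_singleton _ _ (measurableSet_singleton k)]; rfl⟩

lemma integrable_of_summable {ν : Measure ℕ} [IsProbabilityMeasure ν] {w : ℕ → ℝ}
    (hw : ∀ k, 0 ≤ w k) (hν : ∀ k, ν {k} = ENNReal.ofReal (w k)) {f : ℕ → ℝ} (hf : ∀ k, 0 ≤ f k)
    (hs : Summable fun k => f k * w k) : Integrable f ν := by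
  refine ⟨(measurable_of_countable f).aestronglyMeasurable, ?_⟩
  rw [HasFiniteIntegral, lintegral_countable']
  have : ∀ k, ‖f k‖ₑ * ν {k} = ENNReal.ofReal (f k * w k) := fun k => by
    rw [hν, Real.enorm_of_nonneg (hf k), ENNReal.ofReal_mul (hf k)]
  simp_rw [this]
  rw [← ENNReal.ofReal_tsum_of_nonneg (fun k => mul_nonneg (hf k) (hw k)) hs]
  exact ENNReal.ofReal_lt_top

lemma pi_sum_mem {ν : Measure ℕ} [IsProbabilityMeasure ν] {w : ℕ → ℝ}
    (hw : ∀ k, 0 ≤ w k) (hν : ∀ k, ν {k} = ENNReal.ofReal (w k)) (N : ℕ) (I : Finset ℕ) :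
    Measure.pi (fun _ : Fin N => ν) {k | ∑ j, k j ∈ I} =
      ENNReal.ofReal (∑ x ∈ I, sumWeight w N x) := by
  have e : {k : Fin N → ℕ | ∑ j, k j ∈ I} =
      ↑(I.biUnion fun x => Finset.piAntidiag (Finset.univ : Finset (Fin N)) x) := by
    ext k; simp
  rw [e, ← sum_measure_singleton, Finset.sum_biUnion]
  · rw [ENNReal.ofReal_sum_of_nonneg fun x _ => sumWeight_nonneg hw _ _]
    refine Finset.sum_congr rfl fun x _ => ?_
    rw [sumWeight, ENNReal.ofReal_sum_of_nonneg fun k _ => Finset.prod_nonneg fun _ _ => hw _]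
    refine Finset.sum_congr rfl fun k _ => ?_
    rw [Measure.pi_singleton, ENNReal.ofReal_prod_of_nonneg fun _ _ => hw _]
    simp_rw [hν]
  · intro x _ y _ hxy
    rw [Function.onFun, Finset.disjoint_left]
    intro k hk hk'
    simp only [Finset.mem_piAntidiag] at hk hk'
    exact hxy (hk.1.symm.trans hk'.1)

/-- The weak law of large numbers for `sumWeight`. -/
lemma exists_le_sum_sumWeight {w : ℕ → ℝ} (hw : ∀ k, 0 ≤ w k) (h1 : HasSum w 1)
    (h2 : Summable fun k : ℕ => (k : ℝ) ^ 2 * w k) :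
    ∃ V : ℝ, ∀ (N : ℕ) (R : ℝ) (I : Finset ℕ), 0 < R →
      (∀ x : ℕ, |(x : ℝ) - (∑' k : ℕ, (k : ℝ) * w k) * N| < R → x ∈ I) →
        1 - N * V / R ^ 2 ≤ ∑ x ∈ I, sumWeight w N x := by
  obtain ⟨ν, hνp, hν⟩ := exists_measure_of_hasSum hw h1
  have hL : MemLp (fun k : ℕ => (k : ℝ)) 2 ν := by
    rw [memLp_two_iff_integrable_sq (measurable_of_countable _).aestronglyMeasurable]
    exact integrable_of_summable hw hν (fun k => by positivity) h2
  have hmean : ∫ k : ℕ, (k : ℝ) ∂ν = ∑' k : ℕ, (k : ℝ) * w k := by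
    rw [integral_countable (hL.integrable one_le_two)]
    refine tsum_congr fun k => ?_
    rw [measureReal_def, hν, ENNReal.toReal_ofReal (hw k), smul_eq_mul, mul_comm]
  refine ⟨variance (fun k : ℕ => (k : ℝ)) ν, fun N R I hR hI => ?_⟩
  set X : (Fin N → ℕ) → ℝ := ∑ j, fun k : Fin N → ℕ => ((k j : ℕ) : ℝ) with hX
  have hLj : ∀ j : Fin N, MemLp (fun k : Fin N → ℕ => ((k j : ℕ) : ℝ)) 2
      (Measure.pi fun _ : Fin N => ν) := fun j =>
    hL.comp_measurePreserving (measurePreserving_eval (fun _ : Fin N => ν) j)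
  have hXL : MemLp X 2 (Measure.pi fun _ : Fin N => ν) := memLp_finsetSum' _ fun j _ => hLj j
  have hvar : variance X (Measure.pi fun _ : Fin N => ν) =
      N * variance (fun k : ℕ => (k : ℝ)) ν := by
    rw [hX, variance_sum_pi (μ := fun _ : Fin N => ν) (X := fun _ (k : ℕ) => (k : ℝ)) fun _ => hL]
    simp
  have hXm : ∫ k, X k ∂(Measure.pi fun _ : Fin N => ν) = (∑' k : ℕ, (k : ℝ) * w k) * N := by
    simp only [hX, Finset.sum_apply]
    rw [integral_finsetSum _ fun j _ => (hLj j).integrable one_le_two]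
    have : ∀ j : Fin N, ∫ k : Fin N → ℕ, ((k j : ℕ) : ℝ) ∂(Measure.pi fun _ : Fin N => ν) =
        ∑' k : ℕ, (k : ℝ) * w k := fun j => by
      rw [← hmean]
      exact integral_comp_eval (μ := fun _ : Fin N => ν) (f := fun k : ℕ => (k : ℝ))
        (measurable_of_countable _).aestronglyMeasurable
    simp [this, mul_comm]
  have hcheb := meas_ge_le_variance_div_sq hXL hR
  rw [hvar, hXm] at hcheb
  have hsub : {k : Fin N → ℕ | ∑ j, k j ∈ I}ᶜ ⊆
      {k | R ≤ |X k - (∑' k : ℕ, (k : ℝ) * w k) * N|} := by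
    intro k hk
    by_contra h
    refine hk (hI _ ?_)
    simpa [hX] using h
  have hmeas : MeasurableSet {k : Fin N → ℕ | ∑ j, k j ∈ I} := Set.Countable.measurableSet
    (Set.to_countable _)
  have hle := (measure_mono hsub).trans hcheb
  rw [prob_compl_eq_one_sub hmeas, pi_sum_mem hw hν] at hle
  have hS : 0 ≤ ∑ x ∈ I, sumWeight w N x := Finset.sum_nonneg fun _ _ => sumWeight_nonneg hw _ _
  rw [← ENNReal.ofReal_one, ← ENNReal.ofReal_sub _ hS] at hle
  have := (ENNReal.ofReal_le_ofReal_iff (by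
    have := variance_nonneg (fun k : ℕ => (k : ℝ)) ν
    positivity)).1 hle
  linarith

/-- The mean is smaller than some point of positive weight. -/
lemma exists_pos_of_mean_lt {w : ℕ → ℝ} (hw : ∀ k, 0 ≤ w k) (h1 : HasSum w 1)
    (hm : Summable fun k : ℕ => (k : ℝ) * w k) (h0 : 0 < w 0) (hw1 : 0 < w 1) :
    0 < ∑' k : ℕ, (k : ℝ) * w k ∧ ∃ M : ℕ, 0 < w M ∧ ∑' k : ℕ, (k : ℝ) * w k < M := by
  have hpos : 0 < ∑' k : ℕ, (k : ℝ) * w k :=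
    hm.tsum_pos (fun k => mul_nonneg (Nat.cast_nonneg _) (hw k)) 1 (by simpa using hw1)
  refine ⟨hpos, ?_⟩
  by_contra! h
  -- If all mass lay at or below the mean, the terms `(mean - k) * w k` would be nonnegative with
  -- sum zero, yet the term at `k = 0` is positive.
  have hs := (h1.mul_left (∑' k : ℕ, (k : ℝ) * w k)).sub hm.hasSum
  rw [mul_one, sub_self] at hs
  have : 0 < ∑' k : ℕ, ((∑' k : ℕ, (k : ℝ) * w k) * w k - (k : ℝ) * w k) := by
    refine hs.summable.tsum_pos (fun k => ?_) 0 (by simpa using mul_pos hpos h0)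
    rw [← sub_mul]
    rcases (hw k).eq_or_lt with h' | h'
    · simp [← h']
    · exact mul_nonneg (sub_nonneg.2 (h k h')) h'.le
  rw [hs.tsum_eq] at this
  exact lt_irrefl _ this

end MultiColour

/-! ### Subexponential lower bound for exact sums near the mean. -/

namespace MultiColour

/-- Sums close to the mean have at most subexponentially small weight. -/
lemma exists_exp_le_sumWeight {w : ℕ → ℝ} (hw : ∀ k, 0 ≤ w k) (h1 : HasSum w 1)
    (h2 : Summable fun k : ℕ => (k : ℝ) ^ 2 * w k) (h0 : 0 < w 0) (hw1 : 0 < w 1) {α : ℝ}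
    (hα : ∑' k : ℕ, (k : ℝ) * w k = α) {δ : ℝ} (hδ : 0 < δ) :
    ∃ ρ : ℝ, 0 < ρ ∧ ∀ᶠ N : ℕ in atTop, ∀ n : ℕ, |(n : ℝ) - α * N| ≤ ρ * N →
      Real.exp (-δ * N) ≤ sumWeight w N n := by
  have hm : Summable fun k : ℕ => (k : ℝ) * w k := by
    refine h2.of_nonneg_of_le (fun k => mul_nonneg (Nat.cast_nonneg _) (hw k)) fun k => ?_
    refine mul_le_mul_of_nonneg_right ?_ (hw k)
    exact_mod_cast Nat.le_self_pow two_ne_zero k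
  obtain ⟨hα0, M, hM, hαM⟩ := exists_pos_of_mean_lt hw h1 hm h0 hw1
  obtain ⟨V, hV⟩ := exists_le_sum_sumWeight hw h1 h2
  rw [hα] at hα0 hαM hV
  have hM0 : 0 < M := by exact_mod_cast hα0.trans hαM
  set c := min (w 0) (min (w 1) (w M)) with hc
  have hc0 : 0 < c := lt_min h0 (lt_min hw1 hM)
  have hcle : c ≤ 1 := (min_le_left _ _).trans
    (h1.tsum_eq ▸ h1.summable.le_tsum 0 fun _ _ => hw _)
  have hL : 0 ≤ -Real.log c := neg_nonneg.2 (Real.log_nonpos hc0.le hcle)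
  set L := -Real.log c with hLdef
  -- `τ` is the proportion of correcting variables, so small that their cost `c ^ (τ N)` is at least
  -- `exp(-δ N / 2)`. Dividing by `L + 1` covers `L = 0`.
  obtain ⟨τ, hτ0, hτ1, hτL⟩ : ∃ τ : ℝ, 0 < τ ∧ τ ≤ 1 ∧ τ * L ≤ δ / 2 := by
    refine ⟨min 1 (δ / 2 / (L + 1)), by positivity, min_le_left _ _, ?_⟩
    calc min 1 (δ / 2 / (L + 1)) * L ≤ δ / 2 / (L + 1) * (L + 1) := by
          gcongr
          · exact min_le_right _ _
          · linarith
      _ = δ / 2 := by field_simp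
  -- The correction must absorb `2 ρ N`: `ρ N` from `n` and `ρ N` from the weak law. The factor `4`
  -- leaves another `2 ρ N` for rounding `τ N` down and for the slack `M * M`.
  obtain ⟨ρ, hρ0, hρ1, hρ2⟩ : ∃ ρ : ℝ, 0 < ρ ∧ 4 * ρ ≤ α * τ ∧ 4 * ρ ≤ (M - α) * τ := by
    have hMα : 0 < M - α := sub_pos.2 hαM
    refine ⟨min (α * τ) ((M - α) * τ) / 4, by positivity, ?_, ?_⟩
    · linarith [min_le_left (α * τ) ((M - α) * τ)]
    · linarith [min_le_right (α * τ) ((M - α) * τ)]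
  refine ⟨ρ, hρ0, ?_⟩
  have hev : ∀ C : ℝ, ∀ᶠ N : ℕ in atTop, C ≤ N := fun C =>
    tendsto_natCast_atTop_atTop.eventually_ge_atTop C
  filter_upwards [hev 1, hev (α / (2 * ρ)), hev ((M * M + (M - α)) / (2 * ρ)),
    hev (2 * |V| / ρ ^ 2), hev (2 * Real.log 2 / δ)] with N hN1 hA hB hC hD n hn
  rw [div_le_iff₀ (by positivity)] at hA hB hC hD
  have hr1 := Nat.floor_le (by positivity : 0 ≤ τ * (N : ℝ))
  have hr2 := Nat.lt_floor_add_one (τ * (N : ℝ))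
  generalize ⌊τ * (N : ℝ)⌋₊ = r at hr1 hr2
  have hrN : r ≤ N := by
    have : (r : ℝ) ≤ N := hr1.trans (mul_le_of_le_one_left (by linarith) hτ1)
    exact_mod_cast this
  obtain ⟨N', rfl⟩ := Nat.exists_eq_add_of_le' hrN
  generalize hT : ((N' + r : ℕ) : ℝ) = T at *
  have hN'T : (N' : ℝ) = T - r := by rw [← hT]; push_cast; ring
  have hN'le : (N' : ℝ) ≤ T := by rw [hN'T]; linarith [(Nat.cast_nonneg r : (0 : ℝ) ≤ r)]
  rw [abs_le] at hn
  have hαr : 2 * (ρ * T) ≤ α * r := by nlinarith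
  have hMr : 2 * (ρ * T) + M * M ≤ (M - α) * r := by nlinarith
  -- Typical sums of the first `N'` variables. The cut at `n` removes none of them, by `hαr`, and
  -- keeps `n - x` from truncating.
  set I := (Finset.range (n + 1)).filter fun x : ℕ => |(x : ℝ) - α * N'| < ρ * T
  have hI : ∀ x : ℕ, |(x : ℝ) - α * N'| < ρ * T → x ∈ I := by
    intro x hx
    refine Finset.mem_filter.2 ⟨Finset.mem_range.2 (Nat.lt_succ_of_le ?_), hx⟩
    rw [abs_lt, hN'T] at hx
    have : (x : ℝ) ≤ n := by linarith
    exact_mod_cast this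
  have hhalf : 1 / 2 ≤ ∑ x ∈ I, sumWeight w N' x := by
    refine le_trans ?_ (hV N' (ρ * T) I (by positivity) hI)
    have : N' * V / (ρ * T) ^ 2 ≤ 1 / 2 := by
      rw [div_le_iff₀ (by positivity)]
      calc (N' : ℝ) * V ≤ T * |V| := by
            refine (mul_le_mul_of_nonneg_left (le_abs_self V) (Nat.cast_nonneg _)).trans ?_
            gcongr
        _ ≤ T * (T * ρ ^ 2 / 2) := by gcongr; linarith
        _ = _ := by ring
    linarith
  have hrem : ∀ x ∈ I, c ^ r ≤ sumWeight w r (n - x) := by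
    intro x hx
    obtain ⟨hx1, hx2⟩ := Finset.mem_filter.1 hx
    have hxn : x ≤ n := Nat.lt_succ_iff.1 (Finset.mem_range.1 hx1)
    rw [abs_lt, hN'T] at hx2
    refine pow_le_sumWeight hw hc0.le hM0 (min_le_left _ _)
      ((min_le_right _ _).trans (min_le_left _ _)) ((min_le_right _ _).trans (min_le_right _ _)) ?_
    have : ((n - x : ℕ) : ℝ) + M * M ≤ M * r := by
      rw [Nat.cast_sub hxn]
      linarith
    exact_mod_cast this
  have hcr : Real.exp (-(δ / 2) * T) ≤ c ^ r := by
    rw [← Real.exp_log hc0, ← Real.exp_nat_mul, Real.exp_le_exp]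
    have : (r : ℝ) * L ≤ δ / 2 * T := by
      calc (r : ℝ) * L ≤ τ * T * L := by gcongr
        _ = τ * L * T := by ring
        _ ≤ δ / 2 * T := by gcongr
    rw [show Real.log c = -L by rw [hLdef, neg_neg]]
    linarith
  have hexp : Real.exp (-(δ / 2) * T) ≤ 1 / 2 := by
    rw [← Real.exp_log (by norm_num : (0 : ℝ) < 1 / 2), Real.exp_le_exp, one_div, Real.log_inv]
    linarith
  calc Real.exp (-δ * T) = Real.exp (-(δ / 2) * T) * Real.exp (-(δ / 2) * T) := by
        rw [← Real.exp_add]; ring_nf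
    _ ≤ (∑ x ∈ I, sumWeight w N' x) * c ^ r := by
        gcongr
        · exact hexp.trans hhalf
    _ ≤ ∑ x ∈ I, sumWeight w N' x * sumWeight w r (n - x) := by
        rw [Finset.sum_mul]
        exact Finset.sum_le_sum fun x hx =>
          mul_le_mul_of_nonneg_left (hrem x hx) (sumWeight_nonneg hw _ _)
    _ ≤ ∑ x ∈ Finset.range (n + 1), sumWeight w N' x * sumWeight w r (n - x) :=
        Finset.sum_le_sum_of_subset_of_nonneg (Finset.filter_subset _ _) fun _ _ _ =>
          mul_nonneg (sumWeight_nonneg hw _ _) (sumWeight_nonneg hw _ _)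
    _ = sumWeight w (N' + r) n := by
        rw [sumWeight_add, Finset.Nat.sum_antidiagonal_eq_sum_range_succ
          fun x y => sumWeight w N' x * sumWeight w r y]

end MultiColour

/-! ### Power series weights and change of parameter. -/

namespace MultiColour

lemma hasSum_weight {b : ℕ → ℝ} {θ : ℝ} (hB : B b θ ≠ 0)
    (hs : Summable fun k : ℕ => b k * θ ^ k / (k.factorial : ℝ)) : HasSum (weight b θ) 1 := by
  have h := hs.hasSum.div_const (B b θ)
  rw [show (∑' k : ℕ, b k * θ ^ k / (k.factorial : ℝ)) = B b θ from rfl, div_self hB] at h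
  simp only [div_div] at h
  exact h

lemma B_pos {b : ℕ → ℝ} (hb : ∀ k, 0 ≤ b k) (hb0 : 0 < b 0) {θ : ℝ} (hθ : 0 < θ)
    (hs : Summable fun k : ℕ => b k * θ ^ k / (k.factorial : ℝ)) : 0 < B b θ :=
  hs.tsum_pos (fun k => by have := hb k; positivity) 0 (by simpa using hb0)

/-- Strictly inside the disc of convergence the terms decay geometrically, which beats any power of
`k`. The case `m = 2` supplies the second moment for Chebyshev. -/
lemma summable_of_lt_convRadius {b : ℕ → ℝ} (hb : ∀ k, 0 ≤ b k) {θ : ℝ} (hθ : 0 < θ)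
    (hR : ENNReal.ofReal θ < convRadius b) (m : ℕ) :
    Summable fun k : ℕ => (k : ℝ) ^ m * (b k * θ ^ k / (k.factorial : ℝ)) := by
  obtain ⟨a, ha, C, hC, h⟩ :=
    FormalMultilinearSeries.norm_mul_pow_le_mul_pow_of_lt_radius (r := θ.toNNReal) _ hR
  have hs : Summable fun k : ℕ => C * ((k : ℝ) ^ m * a ^ k) :=
    (summable_pow_mul_geometric_of_norm_lt_one m
      (by rw [Real.norm_of_nonneg ha.1.le]; exact ha.2)).mul_left C
  refine hs.of_nonneg_of_le (fun k => by have := hb k; positivity) fun k => ?_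
  have hk := h k
  rw [FormalMultilinearSeries.ofScalars_norm, Real.norm_of_nonneg (by have := hb k; positivity),
    Real.coe_toNNReal _ hθ.le] at hk
  calc (k : ℝ) ^ m * (b k * θ ^ k / (k.factorial : ℝ))
      = (k : ℝ) ^ m * (b k / (k.factorial : ℝ) * θ ^ k) := by ring
    _ ≤ (k : ℝ) ^ m * (C * a ^ k) := by gcongr
    _ = _ := by ring

lemma weight_nonneg {b : ℕ → ℝ} (hb : ∀ k, 0 ≤ b k) {θ : ℝ} (hθ : 0 < θ) (hB : 0 < B b θ) (k : ℕ) :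
    0 ≤ weight b θ k := by
  have := hb k
  unfold weight
  positivity

/-- The parameter enters only through a factor fixed by `N` and the sum, hence cancels under
conditioning. -/
lemma prod_weight (b : ℕ → ℝ) (θ : ℝ) {N n : ℕ} {k : Fin N → ℕ} (hk : ∑ j, k j = n) :
    ∏ j, weight b θ (k j) =
      θ ^ n * (B b θ)⁻¹ ^ N * ∏ j, (b (k j) / ((k j).factorial : ℝ)) := by
  have h : ∀ m, weight b θ m = θ ^ m * (B b θ)⁻¹ * (b m / (m.factorial : ℝ)) := fun m => by
    unfold weight
    rw [div_mul_eq_div_div, div_eq_mul_inv _ (B b θ)]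
    ring
  simp_rw [h, Finset.prod_mul_distrib, Finset.prod_pow_eq_pow_sum, hk]
  simp

lemma sumWeight_weight (b : ℕ → ℝ) (θ : ℝ) (N n : ℕ) :
    sumWeight (weight b θ) N n =
      θ ^ n * (B b θ)⁻¹ ^ N * sumWeight (fun k => b k / (k.factorial : ℝ)) N n := by
  rw [sumWeight, sumWeight, Finset.mul_sum]
  refine Finset.sum_congr rfl fun k hk => prod_weight b θ ?_
  simpa using hk

/-- The conditional weights do not depend on the parameter. -/
lemma prod_weight_div_sumWeight (b : ℕ → ℝ) {θ θ' : ℝ} (hθ : θ ≠ 0) (hθ' : θ' ≠ 0)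
    (hB : B b θ ≠ 0) (hB' : B b θ' ≠ 0) {N n : ℕ} {k : Fin N → ℕ} (hk : ∑ j, k j = n) :
    (∏ j, weight b θ (k j)) / sumWeight (weight b θ) N n =
      (∏ j, weight b θ' (k j)) / sumWeight (weight b θ') N n := by
  rw [prod_weight b θ hk, prod_weight b θ' hk, sumWeight_weight, sumWeight_weight,
    mul_div_mul_left _ _ (by positivity), mul_div_mul_left _ _ (by positivity)]

lemma sumWeight_weight_pos_iff (b : ℕ → ℝ) {θ θ' : ℝ} (hθ : 0 < θ) (hθ' : 0 < θ')
    (hB : 0 < B b θ) (hB' : 0 < B b θ') (N n : ℕ) :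
    0 < sumWeight (weight b θ) N n ↔ 0 < sumWeight (weight b θ') N n := by
  rw [sumWeight_weight, sumWeight_weight, mul_pos_iff_of_pos_left (by positivity),
    mul_pos_iff_of_pos_left (by positivity)]

/-! ### Conditional laws and domination by a product measure. -/

section Array

variable {Ω' : Type*} [MeasurableSpace Ω'] {Q : Measure Ω'} {K N : ℕ} {b : Fin K → ℕ → ℝ}
  {θ : Fin K → ℝ} {ξ : Fin K → Fin N → Ω' → ℕ}

lemma IsPowerSeriesArray.measure_row_eq (h : IsPowerSeriesArray Q b θ ξ)
    (hw : ∀ i k, 0 ≤ weight (b i) (θ i) k) (i : Fin K) (k : Fin N → ℕ) :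
    Q {ω | ∀ j, ξ i j ω = k j} = ENNReal.ofReal (∏ j, weight (b i) (θ i) (k j)) := by
  have hi : iIndepFun (fun j => ξ i j) Q :=
    h.indep.precomp (g := fun j : Fin N => (i, j)) fun j j' e => (Prod.mk.inj e).2
  have e : {ω | ∀ j, ξ i j ω = k j} = ⋂ j ∈ Finset.univ, ξ i j ⁻¹' {k j} := by
    ext ω; simp
  rw [e, hi.measure_inter_preimage_eq_mul Finset.univ fun j _ => measurableSet_singleton (k j),
    ENNReal.ofReal_prod_of_nonneg fun _ _ => hw _ _]
  exact Finset.prod_congr rfl fun j _ => h.law i j (k j)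

lemma IsPowerSeriesArray.measurableSet_row (h : IsPowerSeriesArray Q b θ ξ) (i : Fin K)
    (T : Set (Fin N → ℕ)) : MeasurableSet ((fun ω j => ξ i j ω) ⁻¹' T) :=
  (measurable_pi_lambda _ fun j => h.measurable i j) (Set.to_countable T).measurableSet

lemma IsPowerSeriesArray.measure_sumEvent (h : IsPowerSeriesArray Q b θ ξ)
    (hw : ∀ i k, 0 ≤ weight (b i) (θ i) k) (n : Fin K → ℕ) (i : Fin K) :
    Q (sumEvent ξ n i) = ENNReal.ofReal (sumWeight (weight (b i) (θ i)) N (n i)) := by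
  have e : sumEvent ξ n i = (fun ω j => ξ i j ω) ⁻¹'
      ↑(Finset.piAntidiag (Finset.univ : Finset (Fin N)) (n i)) := by
    ext ω; simp [sumEvent]
  rw [e, ← sum_measure_preimage_singleton _ fun k _ => h.measurableSet_row i {k}, sumWeight,
    ENNReal.ofReal_sum_of_nonneg fun k _ => Finset.prod_nonneg fun _ _ => hw _ _]
  refine Finset.sum_congr rfl fun k _ => ?_
  rw [← h.measure_row_eq hw i k]
  congr 1
  ext ω
  simp [funext_iff]

lemma IsPowerSeriesArray.cond_sumEvent (h : IsPowerSeriesArray Q b θ ξ)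
    (hw : ∀ i k, 0 ≤ weight (b i) (θ i) k) (n : Fin K → ℕ) (i : Fin K)
    (hpos : 0 < sumWeight (weight (b i) (θ i)) N (n i)) {k : Fin N → ℕ} (hk : ∑ j, k j = n i) :
    ProbabilityTheory.cond Q (sumEvent ξ n i) {ω | ∀ j, ξ i j ω = k j} =
      ENNReal.ofReal ((∏ j, weight (b i) (θ i) (k j)) /
        sumWeight (weight (b i) (θ i)) N (n i)) := by
  have hm : MeasurableSet (sumEvent ξ n i) :=
    h.measurableSet_row i {k | ∑ j, k j = n i}
  have hsub : {ω | ∀ j, ξ i j ω = k j} ⊆ sumEvent ξ n i := by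
    intro ω hω
    simp only [Set.mem_ofPred_eq] at hω
    simp [sumEvent, hω, hk]
  rw [ProbabilityTheory.cond_apply hm, Set.inter_eq_right.2 hsub, h.measure_sumEvent hw,
    h.measure_row_eq hw, ENNReal.ofReal_div_of_pos hpos, ENNReal.div_eq_inv_mul]

/-- The allocation scheme is dominated by the product measure with arbitrary parameters `θ'`. -/
lemma ObeysScheme.measure_le {Ω : Type*} [MeasurableSpace Ω] {P : Measure Ω}
    [IsProbabilityMeasure P] {n : Fin K → ℕ} {η : Fin N → Ω → Fin K → ℕ}
    (hη : ObeysScheme P Q n ξ η) (h : IsPowerSeriesArray Q b θ ξ)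
    (hθ : ∀ i, 0 < θ i) (hB : ∀ i, 0 < B (b i) (θ i)) (hb : ∀ i k, 0 ≤ b i k) {θ' : Fin K → ℝ}
    (hθ' : ∀ i, 0 < θ' i) (hB' : ∀ i, 0 < B (b i) (θ' i)) {ν : Fin K → Measure ℕ}
    [∀ i, IsProbabilityMeasure (ν i)]
    (hν : ∀ i k, ν i {k} = ENNReal.ofReal (weight (b i) (θ' i) k))
    (hpos : ∀ i, 0 < sumWeight (weight (b i) (θ' i)) N (n i)) (A : Set (Fin N → Fin K → ℕ)) :
    P {ω | (fun j => η j ω) ∈ A} ≤ ENNReal.ofReal (∏ i, sumWeight (weight (b i) (θ' i)) N (n i))⁻¹ *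
      Measure.pi (fun _ : Fin N => Measure.pi ν) A := by
  classical
  set Z : Fin K → ℝ := fun i => sumWeight (weight (b i) (θ' i)) N (n i) with hZ
  have hw : ∀ i k, 0 ≤ weight (b i) (θ i) k := fun i => weight_nonneg (hb i) (hθ i) (hB i)
  have hw' : ∀ i k, 0 ≤ weight (b i) (θ' i) k := fun i => weight_nonneg (hb i) (hθ' i) (hB' i)
  set G : Ω → Fin N → Fin K → ℕ := fun ω j => η j ω
  have hG : ∀ T : Set (Fin N → Fin K → ℕ), MeasurableSet (G ⁻¹' T) := fun T =>
    (measurable_pi_lambda _ fun j => hη.measurable j) (Set.to_countable T).measurableSet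
  -- The allocations with the prescribed colour totals: the only points where the scheme specifies
  -- the law.
  set T : Finset (Fin N → Fin K → ℕ) :=
    (Fintype.piFinset fun i => Finset.piAntidiag (Finset.univ : Finset (Fin N)) (n i)).map
      (Equiv.piComm fun _ _ => ℕ).toEmbedding with hT
  have hmem : ∀ k, k ∈ T ↔ ∀ i, ∑ j, k j i = n i := by
    intro k
    simp only [hT, Finset.mem_map_equiv, Fintype.mem_piFinset, Finset.mem_piAntidiag]
    simp
  have hlaw : ∀ k ∈ T, P (G ⁻¹' {k}) =
      ENNReal.ofReal (∏ i, ((∏ j, weight (b i) (θ' i) (k j i)) / Z i)) := by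
    intro k hk
    rw [hmem] at hk
    have e : G ⁻¹' {k} = {ω | ∀ j, η j ω = k j} := by
      ext ω; simp [G, funext_iff]
    rw [e, hη.law k hk, ENNReal.ofReal_prod_of_nonneg fun i _ =>
      div_nonneg (Finset.prod_nonneg fun _ _ => hw' _ _) (hpos i).le]
    refine Finset.prod_congr rfl fun i _ => ?_
    rw [h.cond_sumEvent hw n i ((sumWeight_weight_pos_iff (b i) (hθ i) (hθ' i) (hB i) (hB' i)
      N (n i)).2 (hpos i)) (k := fun j => k j i) (hk i), prod_weight_div_sumWeight (b i) (hθ i).ne'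
      (hθ' i).ne' (hB i).ne' (hB' i).ne' (hk i)]
  -- The sum over `T` factors over colours into normalized sums, so the specified probabilities
  -- already exhaust the mass and nothing lies outside `T`.
  have hone : P (G ⁻¹' ↑T) = 1 := by
    rw [← sum_measure_preimage_singleton _ fun k _ => hG {k}, Finset.sum_congr rfl hlaw,
      ← ENNReal.ofReal_sum_of_nonneg fun k _ => Finset.prod_nonneg fun i _ =>
      div_nonneg (Finset.prod_nonneg fun _ _ => hw' _ _) (hpos i).le, hT, Finset.sum_map]
    have := Finset.prod_univ_sum
      (fun i => Finset.piAntidiag (Finset.univ : Finset (Fin N)) (n i))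
      fun i k => (∏ j, weight (b i) (θ' i) (k j)) / Z i
    simp only [Equiv.coe_toEmbedding, Equiv.piComm_apply, Function.swap]
    rw [← this, ENNReal.ofReal_eq_one]
    refine Finset.prod_eq_one fun i _ => ?_
    rw [← Finset.sum_div]
    exact div_self (hpos i).ne'
  have hnull : P (G ⁻¹' ↑T)ᶜ = 0 := (prob_compl_eq_zero_iff (hG _)).2 hone
  have hsub : {ω | G ω ∈ A} ⊆ G ⁻¹' ↑(T.filter (· ∈ A)) ∪ (G ⁻¹' ↑T)ᶜ := by
    intro ω hω
    by_cases hωT : G ω ∈ T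
    · exact Or.inl (by simpa using ⟨hωT, hω⟩)
    · exact Or.inr (by simpa using hωT)
  calc P {ω | G ω ∈ A} ≤ P (G ⁻¹' ↑(T.filter (· ∈ A))) + P (G ⁻¹' ↑T)ᶜ :=
        (measure_mono hsub).trans (measure_union_le _ _)
    _ = ∑ k ∈ T.filter (· ∈ A), P (G ⁻¹' {k}) := by
        rw [hnull, add_zero, sum_measure_preimage_singleton _ fun k _ => hG {k}]
    _ = ∑ k ∈ T.filter (· ∈ A), ENNReal.ofReal (∏ i, Z i)⁻¹ *
          Measure.pi (fun _ : Fin N => Measure.pi ν) {k} := by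
        refine Finset.sum_congr rfl fun k hk => ?_
        rw [hlaw k (Finset.mem_filter.1 hk).1, Finset.prod_div_distrib, div_eq_inv_mul,
          ENNReal.ofReal_mul (inv_nonneg.2 (Finset.prod_nonneg fun i _ => (hpos i).le)),
          Measure.pi_singleton]
        congr 1
        simp_rw [Measure.pi_singleton, hν]
        rw [Finset.prod_comm, ENNReal.ofReal_prod_of_nonneg fun j _ =>
          Finset.prod_nonneg fun _ _ => hw' _ _]
        exact Finset.prod_congr rfl fun j _ => ENNReal.ofReal_prod_of_nonneg fun _ _ => hw' _ _
    _ = ENNReal.ofReal (∏ i, Z i)⁻¹ *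
          Measure.pi (fun _ : Fin N => Measure.pi ν) ↑(T.filter (· ∈ A)) := by
        rw [← Finset.mul_sum, sum_measure_singleton]
    _ ≤ _ := by
        gcongr
        intro k hk
        exact (Finset.mem_filter.1 (Finset.mem_coe.1 hk)).2

end Array

/-! ### Concentration of the box count under the product measure. -/

/-- Hoeffding's inequality for the number of coordinates in a set. -/
lemma measure_card_filter_le {X : Type*} [MeasurableSpace X] (m : Measure X)
    [IsProbabilityMeasure m] {S : Set X} (hS : MeasurableSet S) [DecidablePred (· ∈ S)] (N : ℕ)
    {ε : ℝ} (hε : 0 ≤ ε) :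
    Measure.pi (fun _ : Fin N => m)
        {k | ε * N ≤ |((Finset.univ.filter fun j => k j ∈ S).card : ℝ) - m.real S * N|} ≤
      ENNReal.ofReal (2 * Real.exp (-2 * ε ^ 2 * N)) := by
  set μ := Measure.pi fun _ : Fin N => m
  have hf : Measurable (S.indicator fun _ => (1 : ℝ)) := measurable_const.indicator hS
  have hind : iIndepFun (fun (j : Fin N) (k : Fin N → X) =>
      S.indicator (fun _ => (1 : ℝ)) (k j) - m.real S) μ :=
    iIndepFun_pi (X := fun _ x => S.indicator (fun _ => (1 : ℝ)) x - m.real S)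
      fun _ => (hf.sub_const _).aemeasurable
  have hsub : ∀ j : Fin N, HasSubgaussianMGF (fun k : Fin N → X =>
      S.indicator (fun _ => (1 : ℝ)) (k j) - m.real S) ((‖(1 : ℝ) - 0‖₊ / 2) ^ 2) μ := by
    intro j
    have h := hasSubgaussianMGF_of_mem_Icc (μ := μ) (a := 0) (b := 1)
      (X := fun k : Fin N → X => S.indicator (fun _ => (1 : ℝ)) (k j))
      (hf.comp (measurable_pi_apply j)).aemeasurable
      (ae_of_all _ fun k => ⟨Set.indicator_nonneg (fun _ _ => zero_le_one) _,
        Set.indicator_le_self' (fun _ _ => zero_le_one) _⟩)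
    have e : ∫ k : Fin N → X, S.indicator (fun _ => (1 : ℝ)) (k j) ∂μ = m.real S := by
      rw [integral_comp_eval (μ := fun _ : Fin N => m) (f := S.indicator fun _ => (1 : ℝ))
        hf.aestronglyMeasurable, integral_indicator_const _ hS]
      simp
    rwa [e] at h
  have hcount : ∀ k : Fin N → X, ∑ j, (S.indicator (fun _ => (1 : ℝ)) (k j) - m.real S) =
      ((Finset.univ.filter fun j => k j ∈ S).card : ℝ) - m.real S * N := by
    intro k
    rw [Finset.sum_sub_distrib, Finset.card_filter]
    simp [Set.indicator_apply, mul_comm]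
  -- Each centred indicator has variance proxy `1/4`, so the exponent is `-(ε N)² / (N / 2)`; for `N
  -- = 0` both sides are `1`.
  have hexp : Real.exp (-(ε * N) ^ 2 /
      (2 * ((∑ _j : Fin N, (‖(1 : ℝ) - 0‖₊ / 2) ^ 2 : NNReal) : ℝ))) =
      Real.exp (-2 * ε ^ 2 * N) := by
    congr 1
    rcases N.eq_zero_or_pos with rfl | hN
    · simp
    · have : (N : ℝ) ≠ 0 := by positivity
      simp
      field_simp
  have hεN : 0 ≤ ε * N := by positivity
  have hup := HasSubgaussianMGF.measure_sum_ge_le_of_iIndepFun hind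
    (s := Finset.univ) (fun j _ => hsub j) hεN
  have hlow := HasSubgaussianMGF.measure_sum_ge_le_of_iIndepFun
    (hind.comp (fun _ x => -x) fun _ => measurable_neg) (s := Finset.univ)
    (fun j _ => (hsub j).neg) hεN
  have hlow' : μ.real {k : Fin N → X | ε * N ≤
      -(((Finset.univ.filter fun j => k j ∈ S).card : ℝ) - m.real S * N)} ≤
      Real.exp (-2 * ε ^ 2 * N) := by
    rw [← hexp]
    simpa only [← hcount, Finset.sum_neg_distrib, Function.comp_apply] using hlow
  simp only [hcount] at hup
  rw [hexp] at hup
  refine (measure_mono (t := {k : Fin N → X | ε * N ≤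
      ((Finset.univ.filter fun j => k j ∈ S).card : ℝ) - m.real S * N} ∪ {k : Fin N → X | ε * N ≤
      -(((Finset.univ.filter fun j => k j ∈ S).card : ℝ) - m.real S * N)})
    fun k hk => by simpa only [Set.mem_union, Set.mem_ofPred_eq, le_abs] using hk).trans ?_
  refine (measure_union_le _ _).trans ?_
  rw [two_mul, ENNReal.ofReal_add (Real.exp_pos _).le (Real.exp_pos _).le]
  exact add_le_add
    ((ENNReal.le_ofReal_iff_toReal_le (measure_ne_top _ _) (Real.exp_pos _).le).2 hup)
    ((ENNReal.le_ofReal_iff_toReal_le (measure_ne_top _ _) (Real.exp_pos _).le).2 hlow')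

end MultiColour

/-! ### Almost sure statements along the sector limit. -/

namespace MultiColour

lemma tendsto_sectorLimit_snd {K : ℕ} (α : Fin K → ℝ) :
    Tendsto (fun p : (Fin K → ℕ) × ℕ => p.2) (sectorLimit α) atTop :=
  tendsto_comap.mono_left (inf_le_left.trans inf_le_left)

lemma tendsto_sectorLimit_div {K : ℕ} (α : Fin K → ℝ) (i : Fin K) :
    Tendsto (fun p : (Fin K → ℕ) × ℕ => (p.1 i : ℝ) / (p.2 : ℝ)) (sectorLimit α) (𝓝 (α i)) :=
  tendsto_comap.mono_left (inf_le_right.trans (iInf_le _ i))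

/-- Identifies the limit in the theorem as the probability that one box holds `s` balls under the
product law. -/
lemma measureReal_pi_sum_eq {K : ℕ} {w : Fin K → ℕ → ℝ} (hw : ∀ i k, 0 ≤ w i k)
    {ν : Fin K → Measure ℕ} [∀ i, IsProbabilityMeasure (ν i)]
    (hν : ∀ i k, ν i {k} = ENNReal.ofReal (w i k)) (s : ℕ) :
    (Measure.pi ν).real {v | ∑ i, v i = s} =
      ∑ v ∈ Finset.piAntidiag (Finset.univ : Finset (Fin K)) s, ∏ i, w i (v i) := by
  have e : {v : Fin K → ℕ | ∑ i, v i = s} =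
      ↑(Finset.piAntidiag (Finset.univ : Finset (Fin K)) s) := by
    ext v; simp
  rw [e, measureReal_def, ← sum_measure_singleton, ENNReal.toReal_sum fun _ _ => measure_ne_top _ _]
  refine Finset.sum_congr rfl fun v _ => ?_
  rw [Measure.pi_singleton, ENNReal.toReal_prod]
  exact Finset.prod_congr rfl fun i _ => by rw [hν, ENNReal.toReal_ofReal (hw _ _)]

/-- A union bound over all `n` in a sector, followed by the Borel–Cantelli lemma. -/
lemma ae_eventually_sectorLimit {Ω : Type*} [MeasurableSpace Ω] {P : Measure Ω} {K : ℕ}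
    {α ρ : Fin K → ℝ} (hρ : ∀ i, 0 < ρ i) {a : ℝ} (ha : 0 < a)
    {E : (Fin K → ℕ) → ℕ → Set Ω}
    (hE : ∀ᶠ N : ℕ in atTop, ∀ n : Fin K → ℕ, (∀ i, |(n i : ℝ) - α i * N| ≤ ρ i * N) →
      P (E n N) ≤ ENNReal.ofReal (2 * Real.exp (-a * N))) :
    ∀ᵐ ω ∂P, ∀ᶠ p in sectorLimit α, ω ∉ E p.1 p.2 := by
  obtain ⟨N₀, hN₀⟩ := eventually_atTop.1 (hE.and (eventually_ge_atTop 1))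
  obtain ⟨C', hC'⟩ := Finite.exists_le fun i => α i + ρ i
  obtain ⟨C, hC⟩ := exists_nat_ge C'
  -- One bad event per `N`, gathering all `n` in the sector. Requiring `N₀ ≤ N` makes it empty where
  -- `hE` gives no bound; otherwise `n i ≤ C * N` leaves at most `(C * N + 1) ^ K` choices.
  set F : ℕ → Set Ω := fun N => {ω | N₀ ≤ N ∧ ∃ n : Fin K → ℕ,
    (∀ i, |(n i : ℝ) - α i * N| ≤ ρ i * N) ∧ ω ∈ E n N} with hF
  have hbound : ∀ N, P (F N) ≤
      ENNReal.ofReal (((C + 1) ^ K * 2) * ((N : ℝ) ^ K * Real.exp (-a * N))) := by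
    intro N
    by_cases hN : N₀ ≤ N
    swap
    · simp [hF, hN]
    obtain ⟨hN1, hN2⟩ := hN₀ N hN
    have hsub : F N ⊆ ⋃ n ∈ Fintype.piFinset fun _ : Fin K => Finset.range (C * N + 1),
        {ω | (∀ i, |(n i : ℝ) - α i * N| ≤ ρ i * N) ∧ ω ∈ E n N} := by
      rintro ω ⟨-, n, hn, hω⟩
      simp only [Set.mem_iUnion]
      refine ⟨n, Fintype.mem_piFinset.2 fun i => Finset.mem_range.2 (Nat.lt_succ_of_le ?_), hn, hω⟩
      have h1 := (abs_le.1 (hn i)).2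
      have h2 : (α i + ρ i) * N ≤ C * N :=
        mul_le_mul_of_nonneg_right ((hC' i).trans hC) (Nat.cast_nonneg _)
      have : (n i : ℝ) ≤ C * N := by linarith
      exact_mod_cast this
    refine (measure_mono hsub).trans ((measure_biUnion_finset_le _ _).trans ?_)
    refine (Finset.sum_le_card_nsmul _ _ (ENNReal.ofReal (2 * Real.exp (-a * N)))
      fun n _ => ?_).trans ?_
    · by_cases hn : ∀ i, |(n i : ℝ) - α i * N| ≤ ρ i * N
      · exact (measure_mono fun ω hω => hω.2).trans (hN1 n hn)
      · simp [hn]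
    · rw [← ENNReal.ofReal_nsmul]
      refine ENNReal.ofReal_le_ofReal ?_
      rw [Fintype.card_piFinset_const, Finset.card_range, nsmul_eq_mul]
      have h1 : (1 : ℝ) ≤ N := by exact_mod_cast hN2
      calc (((C * N + 1) ^ K : ℕ) : ℝ) * (2 * Real.exp (-a * N))
          ≤ (((C : ℝ) + 1) * N) ^ K * (2 * Real.exp (-a * N)) := by
            push_cast
            gcongr
            linarith
        _ = _ := by rw [mul_pow]; ring
  have hsum : Summable fun N : ℕ => ((C + 1 : ℝ) ^ K * 2) * ((N : ℝ) ^ K * Real.exp (-a * N)) :=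
    (Real.summable_pow_mul_exp_neg_nat_mul K ha).mul_left _
  have hfin : ∑' N, P (F N) ≠ ⊤ := by
    refine ne_top_of_le_ne_top ?_ (ENNReal.tsum_le_tsum hbound)
    exact hsum.tsum_ofReal_ne_top
  filter_upwards [ae_eventually_notMem hfin] with ω hω
  have hclose : ∀ᶠ p in sectorLimit α, ∀ i, |(p.1 i : ℝ) / (p.2 : ℝ) - α i| < ρ i :=
    eventually_all.2 fun i =>
      (tendsto_sectorLimit_div α i).eventually (eventually_abs_sub_lt (α i) (hρ i))
  filter_upwards [hclose, (tendsto_sectorLimit_snd α).eventually hω,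
    (tendsto_sectorLimit_snd α).eventually (eventually_ge_atTop N₀)] with p hp hpω hpN hE'
  have hN : (0 : ℝ) < p.2 := by exact_mod_cast (hN₀ p.2 hpN).2
  refine hpω ⟨hpN, p.1, fun i => ?_, hE'⟩
  have : (p.1 i : ℝ) - α i * p.2 = ((p.1 i : ℝ) / p.2 - α i) * p.2 := by field_simp
  rw [this, abs_mul, abs_of_pos hN]
  exact mul_le_mul_of_nonneg_right (hp i).le hN.le

end MultiColour

/-! ### Assembly. -/

theorem corollary1p2 {Ω Ω' : Type*} [MeasurableSpace Ω] [MeasurableSpace Ω']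
    (P : Measure Ω) [IsProbabilityMeasure P] (Q : Measure Ω') [IsProbabilityMeasure Q]
    {K : ℕ} (b : Fin K → ℕ → ℝ)
    (hb : ∀ i k, 0 ≤ b i k) (hb0 : ∀ i, 0 < b i 0) (hb1 : ∀ i, 0 < b i 1)
    (θ : (Fin K → ℕ) → ℕ → Fin K → ℝ)
    (ξ : (n : Fin K → ℕ) → (N : ℕ) → Fin K → Fin N → Ω' → ℕ)
    (hξ : ∀ n N, MultiColour.IsPowerSeriesArray Q b (θ n N) (ξ n N))
    (η : (n : Fin K → ℕ) → (N : ℕ) → Fin N → Ω → Fin K → ℕ)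
    (hη : ∀ n N, (∀ i, Q (MultiColour.sumEvent (ξ n N) n i) ≠ 0) →
      MultiColour.ObeysScheme P Q n (ξ n N) (η n N))
    (α₀ θ₀ : Fin K → ℝ) (hθ₀ : ∀ i, 0 < θ₀ i)
    (hθ₀R : ∀ i, ENNReal.ofReal (θ₀ i) < MultiColour.convRadius (b i))
    (hα₀ : ∀ i, MultiColour.mean (b i) (θ₀ i) = α₀ i)
    (s : ℕ) :
    ∀ᵐ ω ∂P, Tendsto
      (fun p : (Fin K → ℕ) × ℕ => (MultiColour.boxCount (η p.1 p.2) s ω : ℝ) / (p.2 : ℝ))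
      (MultiColour.sectorLimit α₀)
      (𝓝 (∑ v ∈ Finset.piAntidiag (Finset.univ : Finset (Fin K)) s,
        ∏ i, b i (v i) * θ₀ i ^ v i /
          (((v i).factorial : ℝ) * MultiColour.B (b i) (θ₀ i)))) := by
  classical
  have hs₀ : ∀ i, Summable fun k : ℕ => b i k * θ₀ i ^ k / (k.factorial : ℝ) := fun i => by
    simpa using MultiColour.summable_of_lt_convRadius (hb i) (hθ₀ i) (hθ₀R i) 0
  have hB₀ : ∀ i, 0 < MultiColour.B (b i) (θ₀ i) := fun i =>
    MultiColour.B_pos (hb i) (hb0 i) (hθ₀ i) (hs₀ i)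
  set w : Fin K → ℕ → ℝ := fun i => MultiColour.weight (b i) (θ₀ i) with hwdef
  have hw : ∀ i k, 0 ≤ w i k := fun i => MultiColour.weight_nonneg (hb i) (hθ₀ i) (hB₀ i)
  have hw1 : ∀ i, HasSum (w i) 1 := fun i => MultiColour.hasSum_weight (hB₀ i).ne' (hs₀ i)
  have hw2 : ∀ i, Summable fun k : ℕ => (k : ℝ) ^ 2 * w i k := fun i => by
    refine ((MultiColour.summable_of_lt_convRadius (hb i) (hθ₀ i) (hθ₀R i) 2).div_const
      (MultiColour.B (b i) (θ₀ i))).congr fun k => ?_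
    simp only [hwdef, MultiColour.weight]
    rw [mul_div_assoc, div_div]
  have hwpos : ∀ i k, 0 < b i k → 0 < w i k := fun i k hk => by
    have h1 := hθ₀ i
    have h2 := hB₀ i
    simp only [hwdef, MultiColour.weight]
    positivity
  choose ν hνp hν using fun i => MultiColour.exists_measure_of_hasSum (hw i) (hw1 i)
  set S : Set (Fin K → ℕ) := {v | ∑ i, v i = s} with hS
  have hlim : ∑ v ∈ Finset.piAntidiag (Finset.univ : Finset (Fin K)) s,
      ∏ i, b i (v i) * θ₀ i ^ v i / (((v i).factorial : ℝ) * MultiColour.B (b i) (θ₀ i)) =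
      (Measure.pi ν).real S :=
    (MultiColour.measureReal_pi_sum_eq hw hν s).symm
  rw [hlim]
  have key : ∀ ε : ℝ, 0 < ε → ∀ᵐ ω ∂P, ∀ᶠ p in MultiColour.sectorLimit α₀,
      ω ∉ {ω | ε * p.2 ≤ |(MultiColour.boxCount (η p.1 p.2) s ω : ℝ) -
        (Measure.pi ν).real S * p.2|} := by
    intro ε hε
    -- The `K` conditionings together cost at most `exp(ε² N)`, half of Hoeffding's exponent; `K +
    -- 1` also allows `K = 0`.
    have hδ : 0 < ε ^ 2 / (K + 1) := by positivity
    choose ρ hρ hZ using fun i => MultiColour.exists_exp_le_sumWeight (hw i) (hw1 i) (hw2 i)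
      (hwpos i 0 (hb0 i)) (hwpos i 1 (hb1 i)) (hα₀ i) hδ
    refine MultiColour.ae_eventually_sectorLimit hρ (by positivity : 0 < ε ^ 2)
      (E := fun n N => {ω | ε * N ≤ |(MultiColour.boxCount (η n N) s ω : ℝ) -
        (Measure.pi ν).real S * N|}) ?_
    filter_upwards [eventually_all.2 hZ] with N hN n hn
    have hpos : ∀ i, 0 < MultiColour.sumWeight (w i) N (n i) := fun i =>
      (Real.exp_pos _).trans_le (hN i (n i) (hn i))
    have hθ := (hξ n N).pos
    have hB : ∀ i, 0 < MultiColour.B (b i) (θ n N i) := fun i =>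
      MultiColour.B_pos (hb i) (hb0 i) (hθ i) ((hξ n N).summable i)
    -- Positivity under `θ₀` transfers to the actual parameters, so the scheme is defined for this
    -- pair.
    have hQ : ∀ i, Q (MultiColour.sumEvent (ξ n N) n i) ≠ 0 := fun i => by
      rw [(hξ n N).measure_sumEvent fun i => MultiColour.weight_nonneg (hb i) (hθ i) (hB i)]
      exact (ENNReal.ofReal_pos.2 ((MultiColour.sumWeight_weight_pos_iff (b i) (hθ i) (hθ₀ i)
        (hB i) (hB₀ i) N (n i)).2 (hpos i))).ne'
    have hdom := (hη n N hQ).measure_le (hξ n N) hθ hB hb hθ₀ hB₀ hν hpos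
      {k | ε * N ≤ |((Finset.univ.filter fun j => k j ∈ S).card : ℝ) - (Measure.pi ν).real S * N|}
    refine hdom.trans ?_
    refine (mul_le_mul_right (MultiColour.measure_card_filter_le (Measure.pi ν)
      (Set.to_countable S).measurableSet N hε.le) _).trans ?_
    rw [← ENNReal.ofReal_mul (inv_nonneg.2 (Finset.prod_nonneg fun i _ => (hpos i).le))]
    refine ENNReal.ofReal_le_ofReal ?_
    have hprod : Real.exp (-ε ^ 2 * N) ≤ ∏ i, MultiColour.sumWeight (w i) N (n i) := by
      calc Real.exp (-ε ^ 2 * N) ≤ ∏ _i : Fin K, Real.exp (-(ε ^ 2 / (K + 1)) * N) := by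
            rw [Finset.prod_const, Finset.card_univ, Fintype.card_fin, ← Real.exp_nat_mul,
              Real.exp_le_exp]
            have : (K : ℝ) * (ε ^ 2 / (K + 1)) ≤ ε ^ 2 := by
              rw [← mul_div_assoc, div_le_iff₀ (by positivity)]
              nlinarith [sq_nonneg ε]
            nlinarith [(Nat.cast_nonneg N : (0 : ℝ) ≤ N)]
        _ ≤ _ := Finset.prod_le_prod (fun _ _ => (Real.exp_pos _).le) fun i _ => hN i (n i) (hn i)
    rw [inv_mul_le_iff₀ (Finset.prod_pos fun i _ => hpos i)]
    calc 2 * Real.exp (-2 * ε ^ 2 * N) =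
          Real.exp (-ε ^ 2 * N) * (2 * Real.exp (-ε ^ 2 * N)) := by
          rw [mul_left_comm, ← Real.exp_add]
          ring_nf
      _ ≤ _ := by gcongr
  -- Countably many tolerances `1 / (m + 1)` give a single null event for all `ε`.
  have hall : ∀ᵐ ω ∂P, ∀ m : ℕ, ∀ᶠ p in MultiColour.sectorLimit α₀,
      ω ∉ {ω | 1 / ((m : ℝ) + 1) * p.2 ≤ |(MultiColour.boxCount (η p.1 p.2) s ω : ℝ) -
        (Measure.pi ν).real S * p.2|} :=
    ae_all_iff.2 fun m => key _ (by positivity)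
  filter_upwards [hall] with ω hω
  rw [Metric.tendsto_nhds]
  intro ε hε
  obtain ⟨m, hm⟩ := exists_nat_one_div_lt hε
  filter_upwards [hω m, (MultiColour.tendsto_sectorLimit_snd α₀).eventually
    (eventually_gt_atTop 0)] with p hp hp0
  have hN : (0 : ℝ) < p.2 := by exact_mod_cast hp0
  have hp' := not_le.1 hp
  rw [Real.dist_eq]
  have : (MultiColour.boxCount (η p.1 p.2) s ω : ℝ) / p.2 - (Measure.pi ν).real S =
      ((MultiColour.boxCount (η p.1 p.2) s ω : ℝ) - (Measure.pi ν).real S * p.2) / p.2 := by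
    field_simp
  rw [this, abs_div, abs_of_pos hN, div_lt_iff₀ hN]
  exact hp'.trans (mul_lt_mul_of_pos_right hm hN)
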